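/- Let $D\subset\mathbb{C}^n$ be a bounded homogeneous domain (a bounded connected open set on which the group of biholomorphic self-maps acts transitively) with $0\in D$. Let $K$ be the Bergman kernel of $D$ and let $$H_z(u,\bar u)=c\sum_{j,k=1}^n\frac{\partial^2\log K(z,z)}{\partial z_j\,\partial\bar z_k}\,u_j\bar u_k$$ be the Bergman metric, where $c>0$ is any fixed normalizing constant. For $f$ holomorphic on $D$ put $$Q_f(z)=\sup_{u\in\mathbb{C}^n\setminus\{0\}}\frac{\bigl|\sum_k \frac{\partial f}{\partial z_k}(z)u_k\bigr|}{H_z(u,\bar u)^{1/2}},\qquad \beta_f=\sup_{z\in D}Q_f(z),\qquad \|f\|_{\mathcal B}=|f(0)|+\beta_f.$$ The Bloch space $\mathcal B(D)$ consists of the holomorphic $f$ on $D$ with $\beta_f<\infty$, and the $*$-little Bloch space $\mathcal B_{0*}(D)$ of those $f\in\mathcal B(D)$ with $Q_f(z)\to0$ as $z\in D$ tends to the distinguished boundary of $D$, i.e. the smallest closed subset of $\overline D$ on which every function continuous on $\overline D$ and holomorphic on $D$ attains its maximum modulus. Both carry the norm $\|\cdot\|_{\mathcal B}$. Let $\mu:D\to(0,\infty)$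 be continuous and let $H^\infty_\mu(D)$ be the space of holomorphic $f$ on $D$ with $\|f\|_\mu=\sup_{z\in D}\mu(z)|f(z)|<\infty$. Put $$\omega(z)=\sup\{|f(z)|: f\in\mathcal B(D),\ f(0)=0,\ \|f\|_{\mathcal B}\le1\},\qquad \omega_0(z)=\sup\{|f(z)|: f\in\mathcal B_{0*}(D),\ f(0)=0,\ \|f\|_{\mathcal B}\le1\}.$$ Let $\psi:D\to\mathbb{C}$ and $\varphi:D\to D$ be holomorphic, let $W_{\psi,\varphi}f=\psi\,(f\circ\varphi)$, and put $$\upsilon_\mu(\psi,\varphi)=\sup_{z\in D}\mu(z)|\psi(z)|\,\omega(\varphi(z)),\qquad \upsilon_{0,\mu}(\psi,\varphi)=\sup_{z\in D}\mu(z)|\psi(z)|\,\omega_0(\varphi(z)).$$ Then: (a) $W_{\psi,\varphi}:\mathcal B(D)\to H^\infty_\mu(D)$ is bounded if and only if $\psi\in H^\infty_\mu(D)$ and $\upsilon_\mu(\psi,\varphi)<\infty$. If it is bounded, then its operator norm is $\|W_{\psi,\varphi}\|=\max\{\|\psi\|_\mu,\upsilon_\mu(\psi,\varphi)\}$. (b)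 $W_{\psi,\varphi}:\mathcal B_{0*}(D)\to H^\infty_\mu(D)$ is bounded if and only if $\psi\in H^\infty_\mu(D)$ and $\upsilon_{0,\mu}(\psi,\varphi)<\infty$. If it is bounded, then its operator norm is $\|W_{\psi,\varphi}\|=\max\{\|\psi\|_\mu,\upsilon_{0,\mu}(\psi,\varphi)\}$. -/

import Mathlib

open MeasureTheory Filter Topology Set
open scoped ENNReal NNReal ComplexConjugate

noncomputable section

namespace BlochWCO

variable {n : ℕ}

/-- The holomorphic automorphisms of `D`: holomorphic self-maps of `D` that have a holomorphic
inverse on `D`. -/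
def IsAut (D : Set (Fin n → ℂ)) (F : (Fin n → ℂ) → (Fin n → ℂ)) : Prop :=
  DifferentiableOn ℂ F D ∧ MapsTo F D D ∧
    ∃ G : (Fin n → ℂ) → (Fin n → ℂ),
      DifferentiableOn ℂ G D ∧ MapsTo G D D ∧ (∀ z ∈ D, G (F z) = z) ∧ ∀ z ∈ D, F (G z) = z

/-- Bounded domains in `ℂⁿ` on which the automorphism group acts transitively. -/
structure IsBoundedHomogeneousDomain (D : Set (Fin n → ℂ)) : Prop where
  isOpen : IsOpen D
  isConnected : IsConnected D
  isBounded : Bornology.IsBounded D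
  homogeneous : ∀ z ∈ D, ∀ w ∈ D, ∃ F, IsAut D F ∧ F z = w

/-! ### The Bergman metric -/

/-- The Bergman space `A²(D)` of square integrable holomorphic functions on `D`
(only the values on `D` matter). -/
def BergmanSpace (D : Set (Fin n → ℂ)) : Set ((Fin n → ℂ) → ℂ) :=
  {f | DifferentiableOn ℂ f D ∧ MemLp f 2 (volume.restrict D)}

/-- `k` represents evaluation at `w` on the Bergman space. On `D` such a `k` is unique. -/
def IsReproducing (D : Set (Fin n → ℂ)) (w : Fin n → ℂ) (k : (Fin n → ℂ) → ℂ) : Prop :=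
  k ∈ BergmanSpace D ∧ ∀ f ∈ BergmanSpace D, f w = ∫ z in D, f z * conj (k z)

open Classical in
/-- The Bergman kernel `K(z, w)`: for `w ∈ D`, the function `K(·, w)` is the element of `A²(D)`
that represents evaluation at `w`. -/
def bergmanKernel (D : Set (Fin n → ℂ)) (z w : Fin n → ℂ) : ℂ :=
  if h : ∃ k, IsReproducing D w k then h.choose z else 0

/-- The Wirtinger derivative `∂F/∂z_j`. -/
def wirtinger (j : Fin n) (F : (Fin n → ℂ) → ℂ) (z : Fin n → ℂ) : ℂ :=
  (1 / 2 : ℂ) *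
    (fderiv ℝ F z (Pi.single j 1) - Complex.I * fderiv ℝ F z (Pi.single j Complex.I))

/-- The Wirtinger derivative `∂F/∂z̄_j`. -/
def wirtingerBar (j : Fin n) (F : (Fin n → ℂ) → ℂ) (z : Fin n → ℂ) : ℂ :=
  (1 / 2 : ℂ) *
    (fderiv ℝ F z (Pi.single j 1) + Complex.I * fderiv ℝ F z (Pi.single j Complex.I))

/-- The function `log K(z, z)`; on `D` the number `K(z, z)` is real and positive. -/
def logKernel (D : Set (Fin n → ℂ)) (z : Fin n → ℂ) : ℂ :=
  ((Real.log (bergmanKernel D z z).re : ℝ) : ℂ)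

/-- The Bergman metric `H_z(u, ū) = c ∑ ∂² log K(z, z) / ∂z_j ∂z̄_k · u_j ū_k`. The constant `c > 0`
is the normalization; `c = 1` and `c = 1 / 2` are both customary. -/
def bergmanMetric (c : ℝ) (D : Set (Fin n → ℂ)) (z u : Fin n → ℂ) : ℝ :=
  c * (∑ j, ∑ k, wirtinger j (wirtingerBar k (logKernel D)) z * u j * conj (u k)).re

/-! ### The Bloch space -/

/-- `∇(f)(z)u = ∑ ∂f/∂z_k (z) u_k`. -/
def grad (f : (Fin n → ℂ) → ℂ) (z u : Fin n → ℂ) : ℂ :=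
  ∑ k, fderiv ℂ f z (Pi.single k 1) * u k

/-- `Q_f(z) = sup_{u ≠ 0} |∇(f)(z)u| / H_z(u, ū)^{1/2}`. -/
def Q (c : ℝ) (D : Set (Fin n → ℂ)) (f : (Fin n → ℂ) → ℂ) (z : Fin n → ℂ) : ℝ≥0∞ :=
  ⨆ (u : Fin n → ℂ) (_ : u ≠ 0), ‖grad f z u‖ₑ / ENNReal.ofReal √(bergmanMetric c D z u)

/-- `β_f = sup_{z ∈ D} Q_f(z)`. -/
def blochSeminorm (c : ℝ) (D : Set (Fin n → ℂ)) (f : (Fin n → ℂ) → ℂ) : ℝ≥0∞ :=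
  ⨆ z ∈ D, Q c D f z

/-- The Bloch space: holomorphic functions on `D` with `β_f < ∞` (only values on `D` matter). -/
def Bloch (c : ℝ) (D : Set (Fin n → ℂ)) : Set ((Fin n → ℂ) → ℂ) :=
  {f | DifferentiableOn ℂ f D ∧ blochSeminorm c D f < ∞}

/-- The Bloch norm `|f(0)| + β_f`. -/
def blochNorm (c : ℝ) (D : Set (Fin n → ℂ)) (f : (Fin n → ℂ) → ℂ) : ℝ≥0∞ :=
  ‖f 0‖ₑ + blochSeminorm c D f

/-- A closed subset `S` of the closure of `D` on which every function that is continuous on the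
closure and holomorphic on `D` attains its maximum modulus. -/
def IsClosedBoundary (D S : Set (Fin n → ℂ)) : Prop :=
  IsClosed S ∧ S ⊆ closure D ∧
    ∀ f : (Fin n → ℂ) → ℂ, ContinuousOn f (closure D) → DifferentiableOn ℂ f D →
      ∃ w ∈ S, ∀ z ∈ closure D, ‖f z‖ ≤ ‖f w‖

/-- The distinguished (Bergman–Shilov) boundary of `D`: the smallest closed boundary. -/
def distinguishedBoundary (D : Set (Fin n → ℂ)) : Set (Fin n → ℂ) :=
  ⋂₀ {S | IsClosedBoundary D S}

/-- The `*`-little Bloch space: `Q_f(z) → 0` as `z ∈ D` tends to the distinguished boundary. -/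
def LittleBloch (c : ℝ) (D : Set (Fin n → ℂ)) : Set ((Fin n → ℂ) → ℂ) :=
  {f | f ∈ Bloch c D ∧ Tendsto (Q c D f) (𝓝ˢ (distinguishedBoundary D) ⊓ 𝓟 D) (𝓝 0)}

/-- `sup {|f(z)| : f ∈ X, f(0) = 0, ‖f‖ ≤ 1}` for a set `X` of Bloch functions. -/
def pointSup (c : ℝ) (D : Set (Fin n → ℂ)) (X : Set ((Fin n → ℂ) → ℂ)) (z : Fin n → ℂ) : ℝ≥0∞ :=
  ⨆ (f : (Fin n → ℂ) → ℂ) (_ : f ∈ X ∧ f 0 = 0 ∧ blochNorm c D f ≤ 1), ‖f z‖ₑ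

/-- `ω(z)`. -/
def omega (c : ℝ) (D : Set (Fin n → ℂ)) : (Fin n → ℂ) → ℝ≥0∞ := pointSup c D (Bloch c D)

/-- `ω₀(z)`. -/
def omega0 (c : ℝ) (D : Set (Fin n → ℂ)) : (Fin n → ℂ) → ℝ≥0∞ := pointSup c D (LittleBloch c D)

/-! ### Weighted spaces and weighted composition operators -/

/-- A weight on `D`: a continuous, strictly positive function. -/
def IsWeight (D : Set (Fin n → ℂ)) (μ : (Fin n → ℂ) → ℝ) : Prop :=
  ContinuousOn μ D ∧ ∀ z ∈ D, 0 < μ z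

/-- `‖f‖_μ = sup_{z ∈ D} μ(z) |f(z)|`. -/
def muNorm (D : Set (Fin n → ℂ)) (μ : (Fin n → ℂ) → ℝ) (f : (Fin n → ℂ) → ℂ) : ℝ≥0∞ :=
  ⨆ z ∈ D, ENNReal.ofReal (μ z) * ‖f z‖ₑ

/-- The weighted space `H^∞_μ(D)`. -/
def HInf (D : Set (Fin n → ℂ)) (μ : (Fin n → ℂ) → ℝ) : Set ((Fin n → ℂ) → ℂ) :=
  {f | DifferentiableOn ℂ f D ∧ muNorm D μ f < ∞}

/-- The weighted composition operator `W_{ψ,φ} f = ψ (f ∘ φ)`. -/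
def wco (ψ : (Fin n → ℂ) → ℂ) (φ : (Fin n → ℂ) → (Fin n → ℂ)) (f : (Fin n → ℂ) → ℂ) :
    (Fin n → ℂ) → ℂ :=
  fun z => ψ z * f (φ z)

/-- `T` maps `X`, with the Bloch norm, boundedly into `H^∞_μ(D)`. -/
def IsBoundedOn (c : ℝ) (D : Set (Fin n → ℂ)) (μ : (Fin n → ℂ) → ℝ)
    (X : Set ((Fin n → ℂ) → ℂ)) (T : ((Fin n → ℂ) → ℂ) → ((Fin n → ℂ) → ℂ)) : Prop :=
  (∀ f ∈ X, T f ∈ HInf D μ) ∧ ∃ C : ℝ≥0, ∀ f ∈ X, muNorm D μ (T f) ≤ C * blochNorm c D f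

/-- The operator norm of `T` from `X`, with the Bloch norm, to `H^∞_μ(D)`:
the supremum of `‖T f‖_μ` over the unit ball of `X`. -/
def opNorm (c : ℝ) (D : Set (Fin n → ℂ)) (μ : (Fin n → ℂ) → ℝ)
    (X : Set ((Fin n → ℂ) → ℂ)) (T : ((Fin n → ℂ) → ℂ) → ((Fin n → ℂ) → ℂ)) : ℝ≥0∞ :=
  ⨆ (f : (Fin n → ℂ) → ℂ) (_ : f ∈ X ∧ blochNorm c D f ≤ 1), muNorm D μ (T f)

/-- `υ_μ(ψ, φ) = sup_{z ∈ D} μ(z) |ψ(z)| ω(φ(z))`. -/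
def upsilon (c : ℝ) (D : Set (Fin n → ℂ)) (μ : (Fin n → ℂ) → ℝ)
    (ψ : (Fin n → ℂ) → ℂ) (φ : (Fin n → ℂ) → (Fin n → ℂ)) : ℝ≥0∞ :=
  ⨆ z ∈ D, ENNReal.ofReal (μ z) * ‖ψ z‖ₑ * omega c D (φ z)

/-- `υ_{0,μ}(ψ, φ) = sup_{z ∈ D} μ(z) |ψ(z)| ω₀(φ(z))`. -/
def upsilon0 (c : ℝ) (D : Set (Fin n → ℂ)) (μ : (Fin n → ℂ) → ℝ)
    (ψ : (Fin n → ℂ) → ℂ) (φ : (Fin n → ℂ) → (Fin n → ℂ)) : ℝ≥0∞ :=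
  ⨆ z ∈ D, ENNReal.ofReal (μ z) * ‖ψ z‖ₑ * omega0 c D (φ z)

end BlochWCO

end

namespace BlochWCO

open MeasureTheory Filter Topology Set
open scoped ENNReal NNReal ComplexConjugate

variable {n : ℕ} {c : ℝ} {D : Set (Fin n → ℂ)} {μ : (Fin n → ℂ) → ℝ}
  {f ψ : (Fin n → ℂ) → ℂ} {φ : (Fin n → ℂ) → (Fin n → ℂ)}

theorem grad_eq_fderiv (f : (Fin n → ℂ) → ℂ) (z u : Fin n → ℂ) :
    grad f z u = fderiv ℂ f z u := by
  conv_rhs => rw [pi_eq_sum_univ' u, map_sum]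
  refine Finset.sum_congr rfl fun k _ => ?_
  rw [map_smul, smul_eq_mul, mul_comm]

theorem grad_const_mul_sub (f : (Fin n → ℂ) → ℂ) (t a : ℂ) (z u : Fin n → ℂ) :
    grad (fun w => t * (f w - a)) z u = t * grad f z u := by
  have h : (fun w => t * (f w - a)) = t • fun w => f w - a := rfl
  rw [grad_eq_fderiv, grad_eq_fderiv, h, fderiv_const_smul_field, Pi.smul_apply, fderiv_sub_const]
  rfl

theorem Q_const_mul_sub (f : (Fin n → ℂ) → ℂ) (t a : ℂ) (z : Fin n → ℂ) :
    Q c D (fun w => t * (f w - a)) z = ‖t‖ₑ * Q c D f z := by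
  simp only [Q, grad_const_mul_sub, enorm_mul, ENNReal.mul_iSup, mul_div_assoc]

theorem blochSeminorm_const_mul_sub (f : (Fin n → ℂ) → ℂ) (t a : ℂ) :
    blochSeminorm c D (fun w => t * (f w - a)) = ‖t‖ₑ * blochSeminorm c D f := by
  simp only [blochSeminorm, Q_const_mul_sub, ENNReal.mul_iSup]

theorem Q_const (a : ℂ) (z : Fin n → ℂ) : Q c D (fun _ => a) z = 0 := by
  simp [Q, grad]

theorem blochSeminorm_const (a : ℂ) : blochSeminorm c D (fun _ => a) = 0 := by
  simp [blochSeminorm, Q_const]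

theorem fderiv_eq_zero_of_Q_eq_zero {z : Fin n → ℂ} (h : Q c D f z = 0) :
    fderiv ℂ f z = 0 := by
  ext u
  rcases eq_or_ne u 0 with rfl | hu
  · simp
  · have h1 : ‖grad f z u‖ₑ / ENNReal.ofReal √(bergmanMetric c D z u) = 0 := by
      simp only [Q, ENNReal.iSup_eq_zero] at h
      exact h u hu
    rw [ENNReal.div_eq_zero_iff] at h1
    have h2 := h1.resolve_right ENNReal.ofReal_ne_top
    rw [enorm_eq_zero, grad_eq_fderiv] at h2
    simpa using h2

theorem eq_of_blochSeminorm_eq_zero (hDo : IsOpen D) (hDc : IsPreconnected D)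
    (hf : DifferentiableOn ℂ f D) (h : blochSeminorm c D f = 0) {z w : Fin n → ℂ}
    (hz : z ∈ D) (hw : w ∈ D) : f z = f w := by
  refine hDo.is_const_of_fderiv_eq_zero hDc hf (fun x hx => ?_) hz hw
  simp only [blochSeminorm, ENNReal.iSup_eq_zero] at h
  exact fderiv_eq_zero_of_Q_eq_zero (h x hx)

/-- A set of Bloch functions that contains the constants and is stable under affine
changes of the values. -/
structure IsAffineStable (c : ℝ) (D : Set (Fin n → ℂ)) (X : Set ((Fin n → ℂ) → ℂ)) : Prop where
  subset_bloch : X ⊆ Bloch c D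
  const_mem : ∀ a : ℂ, (fun _ => a) ∈ X
  const_mul_sub_mem : ∀ f ∈ X, ∀ t a : ℂ, (fun w => t * (f w - a)) ∈ X

theorem isAffineStable_bloch : IsAffineStable c D (Bloch c D) where
  subset_bloch := Subset.rfl
  const_mem a := ⟨differentiableOn_const a, by simp [blochSeminorm_const]⟩
  const_mul_sub_mem f hf t a := by
    refine ⟨(hf.1.sub_const a).const_mul t, ?_⟩
    rw [blochSeminorm_const_mul_sub]
    exact ENNReal.mul_lt_top enorm_lt_top hf.2

theorem isAffineStable_littleBloch : IsAffineStable c D (LittleBloch c D) where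
  subset_bloch _ hf := hf.1
  const_mem a := by
    refine ⟨isAffineStable_bloch.const_mem a, ?_⟩
    have h : Q c D (fun _ => a) = fun _ => 0 := funext fun z => Q_const a z
    rw [h]
    exact tendsto_const_nhds
  const_mul_sub_mem f hf t a := by
    refine ⟨isAffineStable_bloch.const_mul_sub_mem f hf.1 t a, ?_⟩
    have h : Q c D (fun w => t * (f w - a)) = fun z => ‖t‖ₑ * Q c D f z :=
      funext fun z => Q_const_mul_sub f t a z
    rw [h]
    simpa using ENNReal.Tendsto.const_mul hf.2 (Or.inr (enorm_ne_top (x := t)))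

variable {X : Set ((Fin n → ℂ) → ℂ)}

theorem enorm_sub_le_pointSup_mul (hX : IsAffineStable c D X) (hDo : IsOpen D)
    (hDc : IsPreconnected D) (h0 : (0 : Fin n → ℂ) ∈ D) (hf : f ∈ X) {w : Fin n → ℂ}
    (hw : w ∈ D) : ‖f w - f 0‖ₑ ≤ pointSup c D X w * blochSeminorm c D f := by
  obtain ⟨hfd, hlt⟩ := hX.subset_bloch hf
  rcases eq_or_ne (blochSeminorm c D f) 0 with hβ | hβ
  · simp [eq_of_blochSeminorm_eq_zero hDo hDc hfd hβ hw h0]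
  · set β := blochSeminorm c D f with hβ_def
    have hpos : 0 < β.toReal := ENNReal.toReal_pos hβ hlt.ne
    set t : ℂ := ((β.toReal⁻¹ : ℝ) : ℂ)
    have ht : ‖t‖ₑ = β⁻¹ := by
      rw [← ofReal_norm, Complex.norm_real, Real.norm_of_nonneg (by positivity),
        ENNReal.ofReal_inv_of_pos hpos, ENNReal.ofReal_toReal hlt.ne]
    have hle : ‖t * (f w - f 0)‖ₑ ≤ pointSup c D X w := by
      refine le_iSup₂_of_le (fun z => t * (f z - f 0))
        ⟨hX.const_mul_sub_mem f hf t (f 0), by simp, ?_⟩ le_rfl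
      rw [blochNorm, blochSeminorm_const_mul_sub, ht, ← hβ_def, ENNReal.inv_mul_cancel hβ hlt.ne]
      simp
    rw [enorm_mul, ht, mul_comm, ← div_eq_mul_inv] at hle
    exact (ENNReal.div_le_iff hβ hlt.ne).1 hle

theorem muNorm_wco_le (hX : IsAffineStable c D X) (hDo : IsOpen D)
    (hDc : IsPreconnected D) (h0 : (0 : Fin n → ℂ) ∈ D) (hφD : MapsTo φ D D) (hf : f ∈ X) :
    muNorm D μ (wco ψ φ f) ≤
      max (muNorm D μ ψ) (⨆ z ∈ D, ENNReal.ofReal (μ z) * ‖ψ z‖ₑ * pointSup c D X (φ z)) *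
        blochNorm c D f := by
  set M := max (muNorm D μ ψ)
    (⨆ z ∈ D, ENNReal.ofReal (μ z) * ‖ψ z‖ₑ * pointSup c D X (φ z)) with hM
  refine iSup₂_le fun z hz => ?_
  have h1 : ENNReal.ofReal (μ z) * ‖ψ z‖ₑ ≤ M :=
    (le_iSup₂ (f := fun z (_ : z ∈ D) => ENNReal.ofReal (μ z) * ‖ψ z‖ₑ) z hz).trans
      (le_max_left _ _)
  have h2 : ENNReal.ofReal (μ z) * ‖ψ z‖ₑ * pointSup c D X (φ z) ≤ M :=
    (le_iSup₂ (f := fun z (_ : z ∈ D) =>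
      ENNReal.ofReal (μ z) * ‖ψ z‖ₑ * pointSup c D X (φ z)) z hz).trans (le_max_right _ _)
  have h3 : ‖f (φ z)‖ₑ ≤ ‖f 0‖ₑ + pointSup c D X (φ z) * blochSeminorm c D f :=
    calc ‖f (φ z)‖ₑ = ‖f 0 + (f (φ z) - f 0)‖ₑ := by rw [add_sub_cancel]
      _ ≤ ‖f 0‖ₑ + ‖f (φ z) - f 0‖ₑ := enorm_add_le _ _
      _ ≤ _ := by gcongr; exact enorm_sub_le_pointSup_mul hX hDo hDc h0 hf (hφD hz)
  calc ENNReal.ofReal (μ z) * ‖wco ψ φ f z‖ₑ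
      = ENNReal.ofReal (μ z) * ‖ψ z‖ₑ * ‖f (φ z)‖ₑ := by rw [wco, enorm_mul, mul_assoc]
    _ ≤ ENNReal.ofReal (μ z) * ‖ψ z‖ₑ *
        (‖f 0‖ₑ + pointSup c D X (φ z) * blochSeminorm c D f) := by gcongr
    _ = ENNReal.ofReal (μ z) * ‖ψ z‖ₑ * ‖f 0‖ₑ +
        ENNReal.ofReal (μ z) * ‖ψ z‖ₑ * pointSup c D X (φ z) * blochSeminorm c D f := by ring
    _ ≤ M * ‖f 0‖ₑ + M * blochSeminorm c D f := by gcongr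
    _ = M * blochNorm c D f := by rw [blochNorm, mul_add]

theorem opNorm_wco (hX : IsAffineStable c D X) (hDo : IsOpen D)
    (hDc : IsPreconnected D) (h0 : (0 : Fin n → ℂ) ∈ D) (hφD : MapsTo φ D D) :
    opNorm c D μ X (wco ψ φ) =
      max (muNorm D μ ψ) (⨆ z ∈ D, ENNReal.ofReal (μ z) * ‖ψ z‖ₑ * pointSup c D X (φ z)) := by
  refine le_antisymm (iSup₂_le fun f hf => ?_) (max_le ?_ (iSup₂_le fun z hz => ?_))
  · exact (muNorm_wco_le hX hDo hDc h0 hφD hf.1).trans (mul_le_of_le_one_right' hf.2)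
  · refine le_iSup₂_of_le (fun _ => 1) ⟨hX.const_mem 1, ?_⟩ ?_
    · simp [blochNorm, blochSeminorm_const]
    · simp [wco, muNorm]
  · simp only [pointSup, ENNReal.mul_iSup]
    refine iSup₂_le fun f hf => le_iSup₂_of_le f ⟨hf.1, hf.2.2⟩ ?_
    refine le_iSup₂_of_le z hz ?_
    rw [wco, enorm_mul, mul_assoc]

theorem isBoundedOn_wco_iff (hX : IsAffineStable c D X) (hDo : IsOpen D)
    (hDc : IsPreconnected D) (h0 : (0 : Fin n → ℂ) ∈ D) (hψ : DifferentiableOn ℂ ψ D)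
    (hφ : DifferentiableOn ℂ φ D) (hφD : MapsTo φ D D) :
    IsBoundedOn c D μ X (wco ψ φ) ↔
      ψ ∈ HInf D μ ∧
        (⨆ z ∈ D, ENNReal.ofReal (μ z) * ‖ψ z‖ₑ * pointSup c D X (φ z)) < ⊤ := by
  constructor
  · rintro ⟨-, C, hC⟩
    have h : opNorm c D μ X (wco ψ φ) < ⊤ := by
      refine lt_of_le_of_lt (iSup₂_le fun f hf => ?_) (ENNReal.coe_lt_top (r := C))
      exact (hC f hf.1).trans (mul_le_of_le_one_right' hf.2)
    rw [opNorm_wco hX hDo hDc h0 hφD, max_lt_iff] at h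
    exact ⟨⟨hψ, h.1⟩, h.2⟩
  · rintro ⟨⟨-, h1⟩, h2⟩
    have hM := max_lt h1 h2
    have hle := fun f hf => muNorm_wco_le (μ := μ) (ψ := ψ) (f := f) hX hDo hDc h0 hφD hf
    refine ⟨fun f hf => ⟨?_, ?_⟩, (max (muNorm D μ ψ)
      (⨆ z ∈ D, ENNReal.ofReal (μ z) * ‖ψ z‖ₑ * pointSup c D X (φ z))).toNNReal, fun f hf => ?_⟩
    · exact hψ.mul ((hX.subset_bloch hf).1.comp hφ hφD)
    · exact (hle f hf).trans_lt
        (ENNReal.mul_lt_top hM (ENNReal.add_lt_top.2 ⟨enorm_lt_top, (hX.subset_bloch hf).2⟩))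
    · rw [ENNReal.coe_toNNReal hM.ne]
      exact hle f hf

end BlochWCO

theorem mainTheorem1 {n : ℕ} (D : Set (Fin n → ℂ))
    (hD : BlochWCO.IsBoundedHomogeneousDomain D) (h0 : (0 : Fin n → ℂ) ∈ D)
    (c : ℝ) (hc : 0 < c)
    (μ : (Fin n → ℂ) → ℝ) (hμ : BlochWCO.IsWeight D μ)
    (ψ : (Fin n → ℂ) → ℂ) (hψ : DifferentiableOn ℂ ψ D)
    (φ : (Fin n → ℂ) → (Fin n → ℂ)) (hφ : DifferentiableOn ℂ φ D) (hφD : Set.MapsTo φ D D) :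
    ((BlochWCO.IsBoundedOn c D μ (BlochWCO.Bloch c D) (BlochWCO.wco ψ φ) ↔
        ψ ∈ BlochWCO.HInf D μ ∧ BlochWCO.upsilon c D μ ψ φ < ⊤) ∧
      (BlochWCO.IsBoundedOn c D μ (BlochWCO.Bloch c D) (BlochWCO.wco ψ φ) →
        BlochWCO.opNorm c D μ (BlochWCO.Bloch c D) (BlochWCO.wco ψ φ) =
          max (BlochWCO.muNorm D μ ψ) (BlochWCO.upsilon c D μ ψ φ))) ∧
    ((BlochWCO.IsBoundedOn c D μ (BlochWCO.LittleBloch c D) (BlochWCO.wco ψ φ) ↔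
        ψ ∈ BlochWCO.HInf D μ ∧ BlochWCO.upsilon0 c D μ ψ φ < ⊤) ∧
      (BlochWCO.IsBoundedOn c D μ (BlochWCO.LittleBloch c D) (BlochWCO.wco ψ φ) →
        BlochWCO.opNorm c D μ (BlochWCO.LittleBloch c D) (BlochWCO.wco ψ φ) =
          max (BlochWCO.muNorm D μ ψ) (BlochWCO.upsilon0 c D μ ψ φ))) := by
  have hDo := hD.isOpen
  have hDc := hD.isConnected.isPreconnected
  exact ⟨⟨BlochWCO.isBoundedOn_wco_iff BlochWCO.isAffineStable_bloch hDo hDc h0 hψ hφ hφD,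
      fun _ => BlochWCO.opNorm_wco BlochWCO.isAffineStable_bloch hDo hDc h0 hφD⟩,
    ⟨BlochWCO.isBoundedOn_wco_iff BlochWCO.isAffineStable_littleBloch hDo hDc h0 hψ hφ hφD,
      fun _ => BlochWCO.opNorm_wco BlochWCO.isAffineStable_littleBloch hDo hDc h0 hφD⟩⟩
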